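/- Let $\mathbb{C}_{1/2}=\{s\in\mathbb{C}:\Re s>1/2\}$ and let $\mathcal{H}^2$ be the Hilbert space of Dirichlet series $f(s)=\sum_{n\ge 1}a_n n^{-s}$ with $\|f\|^2=\sum_{n\ge1}|a_n|^2<\infty$ and inner product $\langle \sum a_n n^{-s},\sum b_n n^{-s}\rangle=\sum_{n\ge1} a_n\overline{b_n}$; its elements are holomorphic functions on $\mathbb{C}_{1/2}$. Let $\Phi:\mathbb{C}_{1/2}\to\mathbb{C}_{1/2}$ be holomorphic and let $D_\Phi$ be the composition-differentiation operator $D_\Phi f=f'\circ\Phi$ in $\mathcal{H}^2$, with its natural domain $\{f\in\mathcal{H}^2: f'\circ\Phi\in\mathcal{H}^2\}$. Then $D_\Phi$ is self-adjoint on $\mathcal{H}^2$ (as a densely defined, possibly unbounded operator) if and only if there is a real constant $c_1$ such that $\Phi(s)=s+c_1$ for all $s\in\mathbb{C}_{1/2}$. In particular, whenever $D_\Phi$ is a bounded operator from all of $\mathcal{H}^2$ to $\mathcal{H}^2$, this bounded operator is self-adjoint if and only if $\Phi(s)=s+c_1$ on $\mathbb{C}_{1/2}$ for some real constant $c_1$.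 -/

import Mathlib

noncomputable section

namespace HardyDirichlet

/-- The open half-plane `Re s > 1/2`. -/
def halfPlane : Set ℂ := {s : ℂ | 1 / 2 < s.re}

/-- The Hardy-Hilbert space of Dirichlet series `∑ aₙ n⁻ˢ` (`n ≥ 1`) with `∑ |aₙ|² < ∞`. An element
is recorded by its coefficient sequence, so norm and inner product are those of `ℓ²`; the holomorphic
function on the half-plane that it represents is `toFun` below (see `toFun_injOn`: the function
determines the coefficients). -/
abbrev H2 : Type := lp (fun _ : ℕ+ => ℂ) 2

/-- The coefficients of `f` as a sequence on `ℕ`; the index `0` plays no role in a Dirichlet series. -/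
def coeff (f : H2) : ℕ → ℂ := fun n => if h : 0 < n then f ⟨n, h⟩ else 0

/-- The function `s ↦ ∑_{n ≥ 1} aₙ n⁻ˢ`. -/
def toFun (f : H2) : ℂ → ℂ := LSeries (coeff f)

theorem coeff_pnat (f : H2) (n : ℕ+) : coeff f (n : ℕ) = f n :=
  dif_pos n.pos

theorem coeff_add (f g : H2) : coeff (f + g) = coeff f + coeff g := by
  funext n
  by_cases h : 0 < n
  · simp only [coeff, h, dif_pos, Pi.add_apply]
    rfl
  · simp [coeff, h]

theorem coeff_smul (c : ℂ) (f : H2) : coeff (c • f) = c • coeff f := by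
  funext n
  by_cases h : 0 < n
  · simp only [coeff, h, dif_pos, Pi.smul_apply]
    rfl
  · simp [coeff, h]

/-- The Dirichlet series of an element of `H2` converges absolutely on the half-plane. -/
theorem summable_of_mem (f : H2) {s : ℂ} (hs : s ∈ halfPlane) : LSeriesSummable (coeff f) s := by
  have hs' : 1 / 2 < s.re := hs
  have h1 : Summable fun n : ℕ+ => ‖f n‖ ^ (2 : ℕ) := by
    have := (lp.memℓp f).summable (by norm_num)
    simpa using this
  have h1' : Summable fun n : ℕ => ‖coeff f n‖ ^ (2 : ℕ) := by
    have hinj : Function.Injective (fun n : ℕ+ => (n : ℕ)) := PNat.coe_injective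
    refine (hinj.summable_iff ?_).mp ?_
    · intro n hn
      have : ¬ 0 < n := fun h => hn ⟨⟨n, h⟩, rfl⟩
      simp [coeff, this]
    · refine h1.congr fun n => ?_
      simp [coeff_pnat]
  have h2 : Summable fun n : ℕ => ((n : ℝ) ^ (2 * s.re))⁻¹ :=
    Real.summable_nat_rpow_inv.mpr (by linarith)
  refine Summable.of_norm_bounded (h1'.add h2) fun n => ?_
  rcases Nat.eq_zero_or_pos n with rfl | hn
  · simp only [LSeries.term_zero, norm_zero]
    positivity
  · rw [LSeries.norm_term_eq, if_neg hn.ne']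
    have hx : (0 : ℝ) < n := by exact_mod_cast hn
    have hp : (n : ℝ) ^ (2 * s.re) = ((n : ℝ) ^ s.re) ^ (2 : ℕ) := by
      rw [mul_comm, Real.rpow_mul hx.le]
      norm_num
    have hpos : 0 < (n : ℝ) ^ s.re := Real.rpow_pos_of_pos hx _
    rw [hp, div_eq_mul_inv, ← inv_pow]
    nlinarith [sq_nonneg (‖coeff f n‖ - ((n : ℝ) ^ s.re)⁻¹), sq_nonneg ‖coeff f n‖,
      sq_nonneg ((n : ℝ) ^ s.re)⁻¹]

theorem abscissa_le (f : H2) : LSeries.abscissaOfAbsConv (coeff f) ≤ ((1 / 2 : ℝ) : EReal) := by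
  refine LSeries.abscissaOfAbsConv_le_of_forall_lt_LSeriesSummable fun y hy => ?_
  exact summable_of_mem f (by simpa [halfPlane] using hy)

theorem abscissa_lt (f : H2) {s : ℂ} (hs : s ∈ halfPlane) :
    LSeries.abscissaOfAbsConv (coeff f) < (s.re : EReal) :=
  lt_of_le_of_lt (abscissa_le f) (EReal.coe_lt_coe_iff.mpr hs)

theorem differentiableAt_toFun (f : H2) {s : ℂ} (hs : s ∈ halfPlane) :
    DifferentiableAt ℂ (toFun f) s :=
  (LSeries_hasDerivAt (abscissa_lt f hs)).differentiableAt

theorem toFun_add (f g : H2) {s : ℂ} (hs : s ∈ halfPlane) :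
    toFun (f + g) s = toFun f s + toFun g s := by
  unfold toFun
  rw [coeff_add]
  exact LSeries_add (summable_of_mem f hs) (summable_of_mem g hs)

theorem toFun_smul (c : ℂ) (f : H2) (s : ℂ) : toFun (c • f) s = c * toFun f s := by
  unfold toFun
  rw [coeff_smul, LSeries_smul]

theorem toFun_smul_eq (c : ℂ) (f : H2) : toFun (c • f) = fun s => c * toFun f s :=
  funext (toFun_smul c f)

theorem isOpen_halfPlane : IsOpen halfPlane := isOpen_lt continuous_const Complex.continuous_re

theorem deriv_toFun_add (f g : H2) {s : ℂ} (hs : s ∈ halfPlane) :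
    deriv (toFun (f + g)) s = deriv (toFun f) s + deriv (toFun g) s := by
  have h : toFun (f + g) =ᶠ[nhds s] (toFun f + toFun g) := by
    filter_upwards [isOpen_halfPlane.mem_nhds hs] with z hz
    exact toFun_add f g hz
  rw [h.deriv_eq]
  exact deriv_add (differentiableAt_toFun f hs) (differentiableAt_toFun g hs)

theorem deriv_toFun_smul (c : ℂ) (f : H2) {s : ℂ} (hs : s ∈ halfPlane) :
    deriv (toFun (c • f)) s = c * deriv (toFun f) s := by
  rw [toFun_smul_eq]
  exact deriv_const_mul c (differentiableAt_toFun f hs)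

/-- An element of `H2` is determined by the function it represents on the half-plane. -/
theorem toFun_injOn {f g : H2} (h : ∀ s ∈ halfPlane, toFun f s = toFun g s) : f = g := by
  have hlt : ∀ k : H2, LSeries.abscissaOfAbsConv (coeff k) < ⊤ := fun k =>
    lt_of_le_of_lt (abscissa_le k) (EReal.coe_lt_top _)
  have key : ∀ n : ℕ, n ≠ 0 → coeff f n = coeff g n := fun n hn => by
    refine LSeries.eq_of_LSeries_eventually_eq (hlt f) (hlt g) ?_ hn
    filter_upwards [Filter.eventually_gt_atTop (1 / 2 : ℝ)] with x hx
    exact h x (by simpa [halfPlane] using hx)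
  ext n
  have := key n n.pos.ne'
  simpa [coeff_pnat] using this

/-- The composition-differentiation operator `D_Φ f = f' ∘ Φ` in `H2`, for a self-map `Φ` of the
half-plane, with its natural domain: all `f` in `H2` for which `f' ∘ Φ` is again (the function
represented by) an element of `H2`. -/
def compDiff (Φ : ℂ → ℂ) (hΦ : Set.MapsTo Φ halfPlane halfPlane) : H2 →ₗ.[ℂ] H2 where
  domain :=
    { carrier := {f | ∃ g : H2, ∀ s ∈ halfPlane, toFun g s = deriv (toFun f) (Φ s)}
      zero_mem' := ⟨0, fun s hs => by
        have h := deriv_toFun_smul 0 0 (hΦ hs)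
        have h' := toFun_smul 0 0 s
        rw [zero_smul, zero_mul] at h h'
        rw [h, h']⟩
      add_mem' := by
        rintro f₁ f₂ ⟨g₁, h₁⟩ ⟨g₂, h₂⟩
        refine ⟨g₁ + g₂, fun s hs => ?_⟩
        rw [toFun_add _ _ hs, deriv_toFun_add _ _ (hΦ hs), h₁ s hs, h₂ s hs]
      smul_mem' := by
        rintro c f ⟨g, h⟩
        refine ⟨c • g, fun s hs => ?_⟩
        rw [toFun_smul, deriv_toFun_smul _ _ (hΦ hs), h s hs] }
  toFun :=
    { toFun := fun f => f.2.choose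
      map_add' := fun f₁ f₂ => toFun_injOn fun s hs => by
        rw [(f₁ + f₂).2.choose_spec s hs, toFun_add _ _ hs, f₁.2.choose_spec s hs,
          f₂.2.choose_spec s hs]
        exact deriv_toFun_add _ _ (hΦ hs)
      map_smul' := fun c f => toFun_injOn fun s hs => by
        rw [(c • f).2.choose_spec s hs, RingHom.id_apply, toFun_smul, f.2.choose_spec s hs]
        exact deriv_toFun_smul _ _ (hΦ hs) }

theorem mem_compDiff_domain {Φ : ℂ → ℂ} {hΦ : Set.MapsTo Φ halfPlane halfPlane} {f : H2} :
    f ∈ (compDiff Φ hΦ).domain ↔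
      ∃ g : H2, ∀ s ∈ halfPlane, toFun g s = deriv (toFun f) (Φ s) := Iff.rfl

theorem toFun_compDiff {Φ : ℂ → ℂ} {hΦ : Set.MapsTo Φ halfPlane halfPlane}
    (f : (compDiff Φ hΦ).domain) {s : ℂ} (hs : s ∈ halfPlane) :
    toFun (compDiff Φ hΦ f) s = deriv (toFun f) (Φ s) :=
  f.2.choose_spec s hs

end HardyDirichlet

end

/-!
Pairing with `kernel w` evaluates an element of `H2` at `w`, and pairing with `derivKernel w`
evaluates its derivative there. Hence `⟪derivKernel (Φ w), f⟫ = ⟪kernel w, D_Φ f⟫` on the domain of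
`D_Φ`, so if `D_Φ` is self-adjoint it maps `kernel w` to `derivKernel (Φ w)`. Evaluated at `s` this
is a functional equation for `G(z) = ∑ (log n) n⁻ᶻ` (`logSeries_symm`):
`G(Φ(s) + conj w) = G(s + conj (Φ(w)))`.

Since `2ᶻ G(z) → log 2` as `Re z → ∞` (`tendsto_two_cpow_mul_logSeries`), letting `w = t → ∞` along
the reals makes both sides comparable to their leading terms. This forces `Re Φ(t) → ∞`
(`tendsto_re_symbol_atTop`), and then `2 ^ (conj (Φ(t)) - t) → 2 ^ (Φ(s) - s)` for every `s`
(`tendsto_two_cpow_symbol_sub`). The left side does not involve `s`, so `2 ^ (Φ(s) - s)` is constant;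
differentiating, `Φ' = 1` and `Φ(s) = s + c` (`exists_eq_add_const`). Comparing the coefficients of
the two Dirichlet series at `n = 2, 3` shows that `c` is real (`im_eq_zero_of_logSeries_symm`).

Conversely, translation by a real `c` makes `D_Φ` the diagonal operator with the real entries
`-(log n) n⁻ᶜ` on its maximal domain (`translate_eq_iff`), and such an operator is self-adjoint.
A bounded `T` with `T f = f' ∘ Φ` is `D_Φ` with full domain (`compDiff_eq_toPMap`), and the two
notions of self-adjointness agree for it.
-/

noncomputable section

namespace HardyDirichlet

open scoped ComplexConjugate
open Filter Topology Complex

/-! ### Dirichlet series as sums over the positive integers -/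

theorem pnat_cast_ne_zero (n : ℕ+) : ((n : ℕ) : ℂ) ≠ 0 := Nat.cast_ne_zero.mpr n.ne_zero

theorem norm_pnat_cpow (n : ℕ+) (s : ℂ) : ‖((n : ℕ) : ℂ) ^ s‖ = ((n : ℕ) : ℝ) ^ s.re :=
  norm_natCast_cpow_of_pos n.pos s

theorem conj_pnat_cpow (n : ℕ+) (s : ℂ) : conj (((n : ℕ) : ℂ) ^ s) = ((n : ℕ) : ℂ) ^ conj s := by
  rw [cpow_conj _ _ (by rw [natCast_arg]; exact Real.pi_pos.ne), conj_natCast]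

theorem LSeries_eq_tsum_pnat (a : ℕ → ℂ) (s : ℂ) :
    LSeries a s = ∑' n : ℕ+, a n * ((n : ℕ) : ℂ) ^ (-s) := by
  rw [LSeries, ← tsum_pnat_eq_tsum_of_eq_zero (LSeries.term_zero a s)]
  refine tsum_congr fun n => ?_
  rw [LSeries.term_of_ne_zero n.ne_zero, cpow_neg, div_eq_mul_inv]

theorem toFun_eq_tsum (f : H2) (s : ℂ) :
    toFun f s = ∑' n : ℕ+, f n * ((n : ℕ) : ℂ) ^ (-s) := by
  simp only [toFun, LSeries_eq_tsum_pnat, coeff_pnat]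

theorem deriv_toFun_eq_tsum (f : H2) {s : ℂ} (hs : s ∈ halfPlane) :
    deriv (toFun f) s = ∑' n : ℕ+, -(Complex.log (n : ℕ) * f n) * ((n : ℕ) : ℂ) ^ (-s) := by
  simp only [toFun, LSeries_deriv (abscissa_lt f hs), LSeries_eq_tsum_pnat, LSeries.logMul,
    coeff_pnat, ← tsum_neg, neg_mul]

/-- The series `G(z) = ∑ (log n) n⁻ᶻ`, that is, `-ζ'(z)` for `Re z > 1`. -/
def logSeries (z : ℂ) : ℂ := ∑' n : ℕ+, Complex.log (n : ℕ) * ((n : ℕ) : ℂ) ^ (-z)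

/-! ### Reproducing kernels -/

theorem summable_pnat_rpow {a : ℝ} (ha : a < -1) :
    Summable fun n : ℕ+ => ((n : ℕ) : ℝ) ^ a :=
  (Real.summable_nat_rpow.mpr ha).comp_injective PNat.coe_injective

theorem norm_log_pnat (n : ℕ+) : ‖Complex.log (n : ℕ)‖ = Real.log (n : ℕ) := by
  rw [← natCast_log, norm_real, Real.norm_of_nonneg (Real.log_natCast_nonneg _)]

theorem memℓp_two_of_summable_sq {f : ℕ+ → ℂ} (h : Summable fun n => ‖f n‖ ^ 2) :
    Memℓp f 2 := by
  refine memℓp_gen ?_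
  simpa using h

theorem memℓp_kernel {w : ℂ} (hw : w ∈ halfPlane) :
    Memℓp (fun n : ℕ+ => ((n : ℕ) : ℂ) ^ (-conj w)) 2 := by
  refine memℓp_two_of_summable_sq ?_
  have hw' : 1 / 2 < w.re := hw
  refine (summable_pnat_rpow (a := -w.re * 2) (by linarith)).congr fun n => ?_
  rw [norm_pnat_cpow, Real.rpow_mul (Nat.cast_nonneg _)]
  simp

theorem memℓp_derivKernel {w : ℂ} (hw : w ∈ halfPlane) :
    Memℓp (fun n : ℕ+ => -(Complex.log (n : ℕ) * ((n : ℕ) : ℂ) ^ (-conj w))) 2 := by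
  refine memℓp_two_of_summable_sq ?_
  have hw' : 1 / 2 < w.re := hw
  -- With this `ε` both `log n ≤ n ^ ε / ε` and `2 * (ε - Re w) < -1` hold.
  set ε : ℝ := (w.re - 1 / 2) / 2 with hε
  have hε0 : 0 < ε := by rw [hε]; linarith
  refine Summable.of_nonneg_of_le (fun n => by positivity) (fun n => ?_)
    ((summable_pnat_rpow (a := (ε - w.re) * 2) (by linarith)).mul_left ((ε ^ 2)⁻¹))
  have hn : (0 : ℝ) < (n : ℕ) := by exact_mod_cast n.pos
  rw [norm_neg, norm_mul, norm_log_pnat, norm_pnat_cpow, Real.rpow_mul hn.le, Real.rpow_two,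
    ← inv_pow, ← mul_pow]
  refine pow_le_pow_left₀ (mul_nonneg (Real.log_natCast_nonneg _) (by positivity)) ?_ 2
  have h := Real.log_le_rpow_div hn.le hε0
  rw [sub_eq_add_neg, Real.rpow_add hn, ← mul_assoc]
  simp only [neg_re, conj_re]
  gcongr
  rwa [inv_mul_eq_div]

/-- The reproducing kernel at `w`: the coefficients are `n` to the power `-conj w`, so that pairing
with it evaluates at `w`. -/
def kernel {w : ℂ} (hw : w ∈ halfPlane) : H2 := ⟨_, memℓp_kernel hw⟩

/-- The element of `H2` such that pairing with it evaluates the derivative at `w`. -/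
def derivKernel {w : ℂ} (hw : w ∈ halfPlane) : H2 := ⟨_, memℓp_derivKernel hw⟩

theorem kernel_apply {w : ℂ} (hw : w ∈ halfPlane) (n : ℕ+) :
    kernel hw n = ((n : ℕ) : ℂ) ^ (-conj w) := rfl

theorem derivKernel_apply {w : ℂ} (hw : w ∈ halfPlane) (n : ℕ+) :
    derivKernel hw n = -(Complex.log (n : ℕ) * ((n : ℕ) : ℂ) ^ (-conj w)) := rfl

theorem inner_kernel {w : ℂ} (hw : w ∈ halfPlane) (f : H2) :
    inner ℂ (kernel hw) f = toFun f w := by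
  rw [lp.inner_eq_tsum, toFun_eq_tsum]
  refine tsum_congr fun n => ?_
  rw [RCLike.inner_apply, kernel_apply, conj_pnat_cpow, map_neg, conj_conj]

theorem inner_derivKernel {w : ℂ} (hw : w ∈ halfPlane) (f : H2) :
    inner ℂ (derivKernel hw) f = deriv (toFun f) w := by
  rw [lp.inner_eq_tsum, deriv_toFun_eq_tsum f hw]
  refine tsum_congr fun n => ?_
  rw [RCLike.inner_apply, derivKernel_apply, map_neg, map_mul, conj_pnat_cpow, map_neg, conj_conj,
    ← natCast_log, conj_ofReal]
  ring

theorem deriv_toFun_kernel {w z : ℂ} (hw : w ∈ halfPlane) (hz : z ∈ halfPlane) :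
    deriv (toFun (kernel hw)) z = -logSeries (z + conj w) := by
  rw [deriv_toFun_eq_tsum _ hz, logSeries, ← tsum_neg]
  refine tsum_congr fun n => ?_
  rw [kernel_apply, neg_add, cpow_add _ _ (pnat_cast_ne_zero n)]
  ring

theorem toFun_derivKernel {w : ℂ} (hw : w ∈ halfPlane) (s : ℂ) :
    toFun (derivKernel hw) s = -logSeries (s + conj w) := by
  rw [toFun_eq_tsum, logSeries, ← tsum_neg]
  refine tsum_congr fun n => ?_
  rw [derivKernel_apply, neg_add, cpow_add _ _ (pnat_cast_ne_zero n)]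
  ring

/-- The kernels belong to the domain of a self-adjoint `D_Φ`, which turns self-adjointness into a
functional equation for the symbol. -/
theorem logSeries_symm {Φ : ℂ → ℂ} {hΦ : Set.MapsTo Φ halfPlane halfPlane}
    (h : IsSelfAdjoint (compDiff Φ hΦ)) {s w : ℂ} (hs : s ∈ halfPlane) (hw : w ∈ halfPlane) :
    logSeries (Φ s + conj w) = logSeries (s + conj (Φ w)) := by
  have hinner : ∀ f : (compDiff Φ hΦ).domain,
      inner ℂ (derivKernel (hΦ hw)) (f : H2) = inner ℂ (kernel hw) (compDiff Φ hΦ f) := fun f => by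
    rw [inner_derivKernel, inner_kernel, toFun_compDiff f hw]
  have hmem := LinearPMap.mem_adjoint_domain_of_exists (kernel hw) ⟨_, hinner⟩
  have happ := LinearPMap.adjoint_apply_eq h.dense_domain ⟨_, hmem⟩ hinner
  have hgraph : (kernel hw, derivKernel (hΦ hw)) ∈ (compDiff Φ hΦ).adjoint.graph := by
    rw [← happ]
    exact LinearPMap.mem_graph _ ⟨_, hmem⟩
  rw [LinearPMap.isSelfAdjoint_def.mp h, LinearPMap.mem_graph_iff] at hgraph
  obtain ⟨f, hf, hDf⟩ := hgraph
  have := toFun_compDiff f hs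
  rw [hDf, hf] at this
  simp only at this
  rw [toFun_derivKernel, deriv_toFun_kernel hw (hΦ hs), neg_inj] at this
  exact this.symm

/-! ### Asymptotics of the logarithmic series -/

/-- The term `n = 2` dominates the series as `Re z → ∞`, uniformly in `Im z`. -/
theorem tendsto_two_cpow_mul_logSeries :
    Tendsto (fun z : ℂ => (2 : ℂ) ^ z * logSeries z) (comap re atTop) (𝓝 (Real.log 2 : ℂ)) := by
  have hnorm : ∀ (n : ℕ+) (z : ℂ), ‖(2 : ℂ) ^ z * (Complex.log (n : ℕ) * ((n : ℕ) : ℂ) ^ (-z))‖ =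
      Real.log (n : ℕ) * (2 / (n : ℕ) : ℝ) ^ z.re := fun n z => by
    have h2 : ‖(2 : ℂ) ^ z‖ = (2 : ℝ) ^ z.re := norm_pnat_cpow 2 z
    rw [norm_mul, norm_mul, h2, norm_log_pnat, norm_pnat_cpow, Real.div_rpow (by norm_num)
      (Nat.cast_nonneg _), neg_re, Real.rpow_neg (Nat.cast_nonneg _)]
    ring
  have hsum : Summable fun n : ℕ+ => Real.log (n : ℕ) * (2 / (n : ℕ) : ℝ) ^ (2 : ℝ) := by
    refine Summable.of_nonneg_of_le (fun n => mul_nonneg (Real.log_natCast_nonneg _)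
      (by positivity)) (fun n => ?_) ((summable_pnat_rpow (a := -(3 / 2)) (by norm_num)).mul_left 8)
    have hn : (0 : ℝ) < (n : ℕ) := by exact_mod_cast n.pos
    have h := Real.log_le_rpow_div hn.le (ε := 1 / 2) (by norm_num)
    have h' : ((n : ℕ) : ℝ) ^ (-(3 / 2) : ℝ) =
        ((n : ℕ) : ℝ) ^ (1 / 2 : ℝ) * (((n : ℕ) : ℝ) ^ (2 : ℝ))⁻¹ := by
      rw [← Real.rpow_neg hn.le, ← Real.rpow_add hn]
      norm_num
    rw [h', Real.div_rpow (by norm_num) hn.le, div_eq_mul_inv]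
    have hp : 0 < (((n : ℕ) : ℝ) ^ (2 : ℝ))⁻¹ := by positivity
    have h4 : (2 : ℝ) ^ (2 : ℝ) = 4 := by norm_num
    rw [h4]
    nlinarith [mul_le_mul_of_nonneg_right h hp.le]
  have hlim : ∑' n : ℕ+, (if n = 2 then (Real.log 2 : ℂ) else 0) = Real.log 2 := by
    rw [tsum_ite_eq]
  simp only [logSeries, ← tsum_mul_left]
  rw [← hlim]
  refine tendsto_tsum_of_dominated_convergence hsum (fun n => ?_) ?_
  · by_cases h2 : n = 2
    · subst h2
      refine tendsto_const_nhds.congr fun z => ?_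
      have : (2 : ℂ) ^ z * (2 : ℂ) ^ (-z) = 1 := by
        rw [← cpow_add _ _ two_ne_zero, add_neg_cancel, cpow_zero]
      have h22 : (((2 : ℕ+) : ℕ) : ℂ) = 2 := rfl
      rw [h22, mul_left_comm, this]
      simp
    rw [if_neg h2]
    by_cases h1 : n = 1
    · subst h1
      simpa using tendsto_const_nhds
    have h3 : (2 : ℝ) < (n : ℕ) := by
      have : 2 < (n : ℕ) := by
        have h1' : (n : ℕ) ≠ 1 := fun h => h1 (PNat.eq h)
        have h2' : (n : ℕ) ≠ 2 := fun h => h2 (PNat.eq h)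
        have := n.pos
        omega
      exact_mod_cast this
    rw [tendsto_zero_iff_norm_tendsto_zero]
    simp only [hnorm]
    have hdiv : (2 / (n : ℕ) : ℝ) < 1 := (div_lt_one (by linarith)).mpr h3
    have := (tendsto_rpow_atTop_of_base_lt_one _ (by
      have : (0 : ℝ) ≤ 2 / (n : ℕ) := by positivity
      linarith) hdiv).comp (tendsto_comap (f := re) (x := atTop))
    simpa using this.const_mul (Real.log (n : ℕ))
  · have : ∀ᶠ z : ℂ in comap re atTop, 2 ≤ z.re :=
      tendsto_comap.eventually (eventually_ge_atTop (2 : ℝ))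
    filter_upwards [this] with z hz n
    rw [hnorm]
    by_cases h1 : n = 1
    · subst h1
      simp
    have h2 : (2 : ℝ) ≤ (n : ℕ) := by
      have : 2 ≤ (n : ℕ) := by
        have h1' : (n : ℕ) ≠ 1 := fun h => h1 (PNat.eq h)
        have := n.pos
        omega
      exact_mod_cast this
    refine mul_le_mul_of_nonneg_left ?_ (Real.log_natCast_nonneg _)
    exact Real.rpow_le_rpow_of_exponent_ge (by positivity) ((div_le_one (by linarith)).mpr h2) hz

/-! ### The symbol is a translation -/

theorem norm_two_cpow (z : ℂ) : ‖(2 : ℂ) ^ z‖ = (2 : ℝ) ^ z.re := norm_pnat_cpow 2 z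

theorem eventually_ofReal_mem_halfPlane : ∀ᶠ t : ℝ in atTop, (t : ℂ) ∈ halfPlane := by
  filter_upwards [eventually_gt_atTop (1 / 2 : ℝ)] with t ht
  simpa [halfPlane] using ht

theorem tendsto_two_cpow_mul_logSeries_add_ofReal (z : ℂ) :
    Tendsto (fun t : ℝ => (2 : ℂ) ^ (z + t) * logSeries (z + t)) atTop (𝓝 (Real.log 2 : ℂ)) := by
  refine tendsto_two_cpow_mul_logSeries.comp (tendsto_comap_iff.mpr ?_)
  simpa [Function.comp_def] using tendsto_atTop_add_const_left atTop z.re tendsto_id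

/-- Comparing the leading terms of the two sides of the functional equation bounds `Re Φ(t)` below
by `t - const` for large real `t`. -/
theorem tendsto_re_symbol_atTop {Φ : ℂ → ℂ} (hΦ : Set.MapsTo Φ halfPlane halfPlane)
    (h : ∀ s ∈ halfPlane, ∀ w ∈ halfPlane,
      logSeries (Φ s + conj w) = logSeries (s + conj (Φ w))) :
    Tendsto (fun t : ℝ => (Φ t).re) atTop atTop := by
  -- For large `Re z` the norm of `2ᶻ G(z)` lies between these bounds of its limit `log 2`.
  have hlog : (1 / 4 : ℝ) < ‖(Real.log 2 : ℂ)‖ ∧ ‖(Real.log 2 : ℂ)‖ < 1 := by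
    rw [norm_real, Real.norm_of_nonneg (Real.log_nonneg one_le_two)]
    constructor <;> linarith [Real.log_two_gt_d9, Real.log_two_lt_d9]
  have hlow := tendsto_two_cpow_mul_logSeries.norm.eventually (lt_mem_nhds hlog.1)
  obtain ⟨R, hR⟩ := (eventually_comap.mp hlow).exists_forall_of_atTop
  set s : ℂ := ((max R 1 : ℝ) : ℂ) with hs
  have hs1 : s ∈ halfPlane := by
    have : (1 : ℝ) ≤ max R 1 := le_max_right _ _
    simp only [halfPlane, hs, Set.mem_ofPred_eq, ofReal_re]
    linarith
  refine tendsto_atTop_mono' atTop ?_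
    (tendsto_atTop_add_const_right atTop ((Φ s).re - s.re - 2) tendsto_id)
  filter_upwards [eventually_ofReal_mem_halfPlane,
    (tendsto_two_cpow_mul_logSeries_add_ofReal (Φ s)).norm.eventually (gt_mem_nhds hlog.2)]
    with t ht hup
  have hpos : 1 / 2 < (Φ t).re := hΦ ht
  have hlo := hR (s + conj (Φ t)).re (by
    have : R ≤ max R 1 := le_max_left _ _
    simp only [add_re, conj_re, hs, ofReal_re]
    linarith) _ rfl
  have heq := h s hs1 t ht
  rw [conj_ofReal] at heq
  rw [← heq, norm_mul, norm_two_cpow, add_re, conj_re] at hlo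
  rw [norm_mul, norm_two_cpow, add_re, ofReal_re] at hup
  set g := ‖logSeries (Φ s + t)‖
  have hg : 0 ≤ g := norm_nonneg _
  rw [id]
  by_contra! hlt
  -- Otherwise the norms of the two leading terms differ by a factor greater than `2 ^ 2`,
  -- although both are comparable to the same value of `G`.
  have hle : (2 : ℝ) ^ (s.re + (Φ t).re) ≤ 2 ^ ((Φ s).re + t) * (2 : ℝ) ^ (-2 : ℝ) := by
    rw [← Real.rpow_add two_pos]
    exact Real.rpow_le_rpow_of_exponent_le one_le_two (by linarith)
  have h4 : (2 : ℝ) ^ (-2 : ℝ) = 1 / 4 := by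
    rw [Real.rpow_neg two_pos.le]; norm_num
  rw [h4] at hle
  nlinarith [mul_le_mul_of_nonneg_right hle hg]

/-- Both sides of the functional equation at `w = t` are asymptotic to their leading terms as
`t → ∞`, so the quotient of these terms tends to `1`. -/
theorem tendsto_two_cpow_symbol_sub {Φ : ℂ → ℂ} (hΦ : Set.MapsTo Φ halfPlane halfPlane)
    (h : ∀ s ∈ halfPlane, ∀ w ∈ halfPlane,
      logSeries (Φ s + conj w) = logSeries (s + conj (Φ w)))
    {s : ℂ} (hs : s ∈ halfPlane) :
    Tendsto (fun t : ℝ => (2 : ℂ) ^ (conj (Φ t) - t)) atTop (𝓝 ((2 : ℂ) ^ (Φ s - s))) := by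
  have hlog : (Real.log 2 : ℂ) ≠ 0 := ofReal_ne_zero.mpr (Real.log_pos one_lt_two).ne'
  have h1 := tendsto_two_cpow_mul_logSeries_add_ofReal (Φ s)
  have h2 : Tendsto (fun t : ℝ => (2 : ℂ) ^ (s + conj (Φ t)) * logSeries (s + conj (Φ t)))
      atTop (𝓝 (Real.log 2 : ℂ)) := by
    refine tendsto_two_cpow_mul_logSeries.comp (tendsto_comap_iff.mpr ?_)
    simpa [Function.comp_def] using
      tendsto_atTop_add_const_left atTop s.re (tendsto_re_symbol_atTop hΦ h)
  have h3 := (h2.div h1 hlog).const_mul ((2 : ℂ) ^ (Φ s - s))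
  rw [div_self hlog, mul_one] at h3
  refine h3.congr' ?_
  filter_upwards [eventually_ofReal_mem_halfPlane, h1.eventually_ne hlog] with t ht hne
  have heq := h s hs t ht
  rw [conj_ofReal] at heq
  simp only [Pi.div_apply]
  rw [← heq, mul_div_mul_right _ _ (right_ne_zero_of_mul hne), mul_div_assoc',
    div_eq_iff (left_ne_zero_of_mul hne), ← cpow_add _ _ two_ne_zero, ← cpow_add _ _ two_ne_zero]
  congr 1
  ring

/-- By uniqueness of limits `2 ^ (Φ(s) - s)` is constant, so `Φ - id` has derivative zero. -/
theorem exists_eq_add_const {Φ : ℂ → ℂ} (hΦ : Set.MapsTo Φ halfPlane halfPlane)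
    (h : ∀ s ∈ halfPlane, ∀ w ∈ halfPlane,
      logSeries (Φ s + conj w) = logSeries (s + conj (Φ w)))
    (hol : DifferentiableOn ℂ Φ halfPlane) :
    ∃ c : ℂ, ∀ s ∈ halfPlane, Φ s = s + c := by
  have hconst : ∀ s ∈ halfPlane, (2 : ℂ) ^ (Φ s - s) = (2 : ℂ) ^ (Φ 1 - 1) := fun s hs =>
    tendsto_nhds_unique (tendsto_two_cpow_symbol_sub hΦ h hs)
      (tendsto_two_cpow_symbol_sub hΦ h (by norm_num [halfPlane]))
  have hd : ∀ s ∈ halfPlane, HasDerivAt (fun z => Φ z - z) (deriv Φ s - 1) s := fun s hs =>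
    ((hol.differentiableAt (isOpen_halfPlane.mem_nhds hs)).hasDerivAt).sub (hasDerivAt_id s)
  have hzero : Set.EqOn (deriv fun z => Φ z - z) 0 halfPlane := fun s hs => by
    have h1 := (hd s hs).const_cpow (c := 2) (Or.inl two_ne_zero)
    have h2 := h1.congr_of_eventuallyEq (f₁ := fun _ => (2 : ℂ) ^ (Φ 1 - 1)) (by
      filter_upwards [isOpen_halfPlane.mem_nhds hs] with z hz
      exact (hconst z hz).symm)
    have h3 := h2.unique (hasDerivAt_const s _)
    have hl : Complex.log 2 ≠ 0 := by
      have := ofReal_ne_zero.mpr (Real.log_pos one_lt_two).ne'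
      rwa [ofReal_log two_pos.le] at this
    rw [(hd s hs).deriv]
    exact (mul_eq_zero.mp h3).resolve_left
      (mul_ne_zero (by rw [Ne, cpow_eq_zero_iff]; simp) hl)
  have hpre : IsPreconnected halfPlane := (convex_halfSpace_re_gt (1 / 2)).isPreconnected
  obtain ⟨c, hc⟩ := isOpen_halfPlane.exists_is_const_of_deriv_eq_zero hpre
    (fun s hs => (hd s hs).differentiableAt.differentiableWithinAt) hzero
  exact ⟨c, fun s hs => by rw [← hc s hs]; ring⟩

/-- If `nᵃ = n^(conj a)` for `n = 2, 3`, then `a` is real, since `log 2` and `log 3` are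
incommensurable. -/
theorem im_eq_zero_of_cpow_conj_eq {a : ℂ} (h2 : (2 : ℂ) ^ conj a = (2 : ℂ) ^ a)
    (h3 : (3 : ℂ) ^ conj a = (3 : ℂ) ^ a) : a.im = 0 := by
  have key : ∀ n : ℕ, n ≠ 0 → (n : ℂ) ^ conj a = (n : ℂ) ^ a →
      ∃ k : ℤ, Real.log n * a.im = k * Real.pi := fun n hn h => by
    have hn' : (n : ℂ) ≠ 0 := Nat.cast_ne_zero.mpr hn
    rw [cpow_def_of_ne_zero hn', cpow_def_of_ne_zero hn', exp_eq_exp_iff_exists_int] at h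
    obtain ⟨k, hk⟩ := h
    refine ⟨-k, ?_⟩
    rw [← natCast_log] at hk
    have := congrArg im hk
    have hI : ((k : ℂ) * (2 * Real.pi * I)).im = k * (2 * Real.pi) := by simp
    rw [add_im, im_ofReal_mul, im_ofReal_mul, conj_im, hI] at this
    push_cast
    linarith
  obtain ⟨k, hk⟩ := key 2 two_ne_zero (by exact_mod_cast h2)
  obtain ⟨l, hl⟩ := key 3 three_ne_zero (by exact_mod_cast h3)
  by_contra ha
  have hl2 : 0 < Real.log 2 := Real.log_pos (by norm_num)
  have hcross : (l : ℝ) * Real.log 2 = k * Real.log 3 := by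
    push_cast at hk hl
    have hpi := Real.pi_pos.ne'
    apply mul_right_cancel₀ (mul_ne_zero hpi ha)
    linear_combination (Real.log 3 * a.im) * hk - (Real.log 2 * a.im) * hl
  have hk0 : k ≠ 0 := by
    rintro rfl
    simp [ha, hl2.ne'] at hk
  have habs : (l.natAbs : ℝ) * Real.log 2 = k.natAbs * Real.log 3 := by
    have := congrArg abs hcross
    rwa [abs_mul, abs_mul, abs_of_pos hl2, abs_of_pos (Real.log_pos (by norm_num : (1 : ℝ) < 3)),
      ← Int.cast_abs, ← Int.cast_abs, Int.abs_eq_natAbs, Int.abs_eq_natAbs, Int.cast_natCast,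
      Int.cast_natCast] at this
  rw [← Real.log_pow, ← Real.log_pow] at habs
  have hpow : 2 ^ l.natAbs = 3 ^ k.natAbs := by
    exact_mod_cast Real.log_injOn_pos (Set.mem_Ioi.mpr (by positivity))
      (Set.mem_Ioi.mpr (by positivity)) habs
  have hdvd : 3 ∣ 2 ^ l.natAbs := hpow ▸ dvd_pow_self 3 (Int.natAbs_ne_zero.mpr hk0)
  exact absurd (Nat.Prime.dvd_of_dvd_pow Nat.prime_three hdvd) (by norm_num)

/-- A translation satisfying the functional equation has real translation vector, by comparing
the coefficients of two Dirichlet series. -/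
theorem im_eq_zero_of_logSeries_symm {c : ℂ}
    (hc : ∀ s ∈ halfPlane, s + c ∈ halfPlane)
    (h : ∀ s ∈ halfPlane, ∀ w ∈ halfPlane,
      logSeries (s + c + conj w) = logSeries (s + conj (w + c))) : c.im = 0 := by
  have h1 : (1 : ℂ) ∈ halfPlane := by norm_num [halfPlane]
  have h1c := hc 1 h1
  have h1c' : 1 + conj c ∈ halfPlane := by simpa [halfPlane] using h1c
  have heq : derivKernel h1c = derivKernel h1c' := toFun_injOn fun s hs => by
    have := h s hs 1 h1
    rw [toFun_derivKernel, toFun_derivKernel, ← this, map_add, conj_conj, map_one]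
    congr 2
    ring
  have key : ∀ n : ℕ+, n ≠ 1 →
      ((n : ℕ) : ℂ) ^ conj (-(1 + c)) = ((n : ℕ) : ℂ) ^ (-(1 + c)) := fun n hn => by
    have hn1 : (1 : ℝ) < (n : ℕ) := by
      exact_mod_cast lt_of_le_of_ne one_le (Ne.symm hn)
    have := congrFun (congrArg (fun f : H2 => (f : ℕ+ → ℂ)) heq) n
    have hlog : Complex.log (n : ℕ) ≠ 0 := by
      rw [← natCast_log]
      exact ofReal_ne_zero.mpr (Real.log_pos hn1).ne'
    simp only [derivKernel_apply, neg_inj] at this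
    have := mul_left_cancel₀ hlog this
    simpa using this
  have := im_eq_zero_of_cpow_conj_eq (key 2 (by decide)) (key 3 (by decide))
  simpa using this

/-! ### Translations give diagonal operators -/

/-- The `n`-th diagonal entry `-(log n) n⁻ᶜ` of the operator induced by translation by `c`. -/
def eigenvalue (c : ℝ) (n : ℕ) : ℝ := -(Real.log n * (n : ℝ) ^ (-c))

theorem term_eigenvalue_mul (c : ℝ) (f : H2) (s : ℂ) :
    LSeries.term (fun n => eigenvalue c n * coeff f n) s =
      -LSeries.term (LSeries.logMul (coeff f)) (s + c) := by
  funext n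
  rcases eq_or_ne n 0 with rfl | hn
  · simp
  have hn' : (n : ℂ) ≠ 0 := Nat.cast_ne_zero.mpr hn
  rw [Pi.neg_apply, LSeries.term_of_ne_zero hn, LSeries.term_of_ne_zero hn, LSeries.logMul,
    cpow_add _ _ hn', eigenvalue, ofReal_neg, ofReal_mul, natCast_log,
    ofReal_cpow (Nat.cast_nonneg n), ofReal_neg, ofReal_natCast, cpow_neg]
  field_simp

/-- For a translation, `g = f' ∘ Φ` is a condition on coefficients; this identifies the domain of
`D_Φ` with the maximal domain of a diagonal operator. -/
theorem translate_eq_iff {Φ : ℂ → ℂ} (hΦ : Set.MapsTo Φ halfPlane halfPlane) {c : ℝ}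
    (hc : ∀ s ∈ halfPlane, Φ s = s + c) (f g : H2) :
    (∀ s ∈ halfPlane, toFun g s = deriv (toFun f) (Φ s)) ↔
      ∀ n : ℕ+, g n = eigenvalue c n * f n := by
  have hlt : ∀ s ∈ halfPlane, LSeries.abscissaOfAbsConv (coeff f) < (s + c).re := fun s hs =>
    abscissa_lt f (hc s hs ▸ hΦ hs)
  have hsum : ∀ s ∈ halfPlane, LSeriesSummable (fun n => eigenvalue c n * coeff f n) s :=
    fun s hs => by
      rw [LSeriesSummable, term_eigenvalue_mul]
      exact Summable.neg (LSeriesSummable_logMul_of_lt_re (hlt s hs))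
  have hderiv : ∀ s ∈ halfPlane,
      deriv (toFun f) (Φ s) = LSeries (fun n => eigenvalue c n * coeff f n) s := fun s hs => by
    rw [hc s hs, toFun, LSeries_deriv (hlt s hs), LSeries, LSeries, term_eigenvalue_mul]
    exact tsum_neg.symm
  constructor
  · intro h n
    have h1 : (1 : ℂ) ∈ halfPlane := by norm_num [halfPlane]
    have := LSeries.eq_of_LSeries_eventually_eq (f := coeff g)
      ((abscissa_le g).trans_lt (EReal.coe_lt_top _))
      ((hsum 1 h1).abscissaOfAbsConv_le.trans_lt (EReal.coe_lt_top _)) (by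
        filter_upwards [eventually_ofReal_mem_halfPlane] with x hx
        rw [← hderiv _ hx, ← h _ hx, toFun]) n.ne_zero
    simpa only [coeff_pnat] using this
  · intro h s hs
    rw [hderiv s hs, toFun, LSeries_eq_tsum_pnat, LSeries_eq_tsum_pnat]
    simp only [coeff_pnat, h]

theorem compDiff_translation_apply {Φ : ℂ → ℂ} {hΦ : Set.MapsTo Φ halfPlane halfPlane} {c : ℝ}
    (hc : ∀ s ∈ halfPlane, Φ s = s + c) (f : (compDiff Φ hΦ).domain) (n : ℕ+) :
    compDiff Φ hΦ f n = eigenvalue c n * (f : H2) n :=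
  (translate_eq_iff hΦ hc f _).mp (fun _ hs => toFun_compDiff f hs) n

theorem single_mem_compDiff_domain {Φ : ℂ → ℂ} {hΦ : Set.MapsTo Φ halfPlane halfPlane} {c : ℝ}
    (hc : ∀ s ∈ halfPlane, Φ s = s + c) (n : ℕ+) :
    (lp.single 2 n (1 : ℂ) : H2) ∈ (compDiff Φ hΦ).domain := by
  refine mem_compDiff_domain.mpr ⟨lp.single 2 n (eigenvalue c n : ℂ),
    (translate_eq_iff hΦ hc _ _).mpr fun m => ?_⟩
  rcases eq_or_ne m n with rfl | hm
  · simp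
  · simp [hm]

theorem dense_compDiff_domain {Φ : ℂ → ℂ} {hΦ : Set.MapsTo Φ halfPlane halfPlane} {c : ℝ}
    (hc : ∀ s ∈ halfPlane, Φ s = s + c) : Dense ((compDiff Φ hΦ).domain : Set H2) := by
  rw [Submodule.dense_iff_topologicalClosure_eq_top, Submodule.topologicalClosure_eq_top_iff,
    Submodule.eq_bot_iff]
  intro y hy
  ext n
  have := hy _ (single_mem_compDiff_domain hc n)
  rw [lp.inner_single_left] at this
  simpa using this

/-- A real diagonal operator on its maximal domain is self-adjoint. -/
theorem isSelfAdjoint_compDiff_of_translation {Φ : ℂ → ℂ}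
    {hΦ : Set.MapsTo Φ halfPlane halfPlane} {c : ℝ} (hc : ∀ s ∈ halfPlane, Φ s = s + c) :
    IsSelfAdjoint (compDiff Φ hΦ) := by
  have hdense := dense_compDiff_domain (hΦ := hΦ) hc
  have hformal : (compDiff Φ hΦ).IsFormalAdjoint (compDiff Φ hΦ) := fun f g => by
    rw [lp.inner_eq_tsum, lp.inner_eq_tsum]
    refine tsum_congr fun n => ?_
    rw [compDiff_translation_apply hc, compDiff_translation_apply hc, RCLike.inner_apply,
      RCLike.inner_apply, map_mul, conj_ofReal]
    ring
  have hcoeff : ∀ (y : (compDiff Φ hΦ).adjoint.domain) (n : ℕ+),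
      (compDiff Φ hΦ).adjoint y n = eigenvalue c n * (y : H2) n := fun y n => by
    have h := LinearPMap.adjoint_isFormalAdjoint hdense y ⟨_, single_mem_compDiff_domain hc n⟩
    have hsingle : compDiff Φ hΦ ⟨_, single_mem_compDiff_domain hc n⟩ =
        lp.single 2 n (eigenvalue c n : ℂ) := by
      ext m
      rw [compDiff_translation_apply hc]
      rcases eq_or_ne m n with rfl | hm
      · simp
      · simp [hm]
    rw [hsingle, lp.inner_single_right, lp.inner_single_right, RCLike.inner_apply,
      RCLike.inner_apply, one_mul] at h
    have := congrArg conj h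
    rwa [map_mul, conj_ofReal, conj_conj, conj_conj] at this
  refine LinearPMap.isSelfAdjoint_def.mpr (le_antisymm ?_ (hformal.le_adjoint hdense))
  have hspec : ∀ (y : (compDiff Φ hΦ).adjoint.domain), ∀ s ∈ halfPlane,
      toFun ((compDiff Φ hΦ).adjoint y) s = deriv (toFun (y : H2)) (Φ s) := fun y =>
    (translate_eq_iff hΦ hc _ _).mpr (hcoeff y)
  refine ⟨fun y hy => mem_compDiff_domain.mpr ⟨_, hspec ⟨y, hy⟩⟩, fun y z hyz => ?_⟩
  refine toFun_injOn fun s hs => ?_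
  rw [hspec y s hs, toFun_compDiff z hs, hyz]

theorem isSelfAdjoint_compDiff_iff {Φ : ℂ → ℂ} (hol : DifferentiableOn ℂ Φ halfPlane)
    (hΦ : Set.MapsTo Φ halfPlane halfPlane) :
    IsSelfAdjoint (compDiff Φ hΦ) ↔ ∃ c₁ : ℝ, ∀ s ∈ halfPlane, Φ s = s + c₁ := by
  refine ⟨fun h => ?_, fun ⟨c, hc⟩ => isSelfAdjoint_compDiff_of_translation hc⟩
  obtain ⟨c, hc⟩ := exists_eq_add_const hΦ (fun s hs w hw => logSeries_symm h hs hw) hol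
  have him : c.im = 0 := im_eq_zero_of_logSeries_symm (fun s hs => hc s hs ▸ hΦ hs)
    fun s hs w hw => by
      rw [← hc s hs, ← hc w hw]
      exact logSeries_symm h hs hw
  refine ⟨c.re, fun s hs => ?_⟩
  rw [hc s hs]
  congr 1
  exact Complex.ext rfl (by simpa using him)

/-! ### Bounded operators -/

theorem compDiff_eq_toPMap {Φ : ℂ → ℂ} (hΦ : Set.MapsTo Φ halfPlane halfPlane) {T : H2 →L[ℂ] H2}
    (hT : ∀ f : H2, ∀ s ∈ halfPlane, toFun (T f) s = deriv (toFun f) (Φ s)) :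
    compDiff Φ hΦ = (T : H2 →ₗ[ℂ] H2).toPMap ⊤ := by
  refine LinearPMap.ext (Submodule.ext fun f =>
    ⟨fun _ => trivial, fun _ => mem_compDiff_domain.mpr ⟨T f, hT f⟩⟩) fun f hf _ => ?_
  refine toFun_injOn fun s hs => ?_
  rw [toFun_compDiff _ hs]
  exact (hT f s hs).symm

theorem isSelfAdjoint_toPMap_top_iff (T : H2 →L[ℂ] H2) :
    IsSelfAdjoint ((T : H2 →ₗ[ℂ] H2).toPMap ⊤) ↔ IsSelfAdjoint T := by
  rw [LinearPMap.isSelfAdjoint_def, ContinuousLinearMap.isSelfAdjoint_iff',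
    ContinuousLinearMap.toPMap_adjoint_eq_adjoint_toPMap_of_dense T (by simp)]
  refine ⟨fun h => ContinuousLinearMap.ext fun f => ?_, fun h => by rw [h]⟩
  exact (LinearPMap.ext_iff.mp h).2 (x := f) (hf := trivial) (hg := trivial)

end HardyDirichlet

end

theorem mainTheorem7 (Φ : ℂ → ℂ)
    (hol : DifferentiableOn ℂ Φ HardyDirichlet.halfPlane)
    (hΦ : Set.MapsTo Φ HardyDirichlet.halfPlane HardyDirichlet.halfPlane) :
    (IsSelfAdjoint (HardyDirichlet.compDiff Φ hΦ) ↔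
      ∃ c₁ : ℝ, ∀ s ∈ HardyDirichlet.halfPlane, Φ s = s + c₁) ∧
    (∀ T : HardyDirichlet.H2 →L[ℂ] HardyDirichlet.H2,
      (∀ f : HardyDirichlet.H2, ∀ s ∈ HardyDirichlet.halfPlane,
        HardyDirichlet.toFun (T f) s = deriv (HardyDirichlet.toFun f) (Φ s)) →
      (IsSelfAdjoint T ↔ ∃ c₁ : ℝ, ∀ s ∈ HardyDirichlet.halfPlane, Φ s = s + c₁)) := by
  refine ⟨HardyDirichlet.isSelfAdjoint_compDiff_iff hol hΦ, fun T hT => ?_⟩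
  rw [← HardyDirichlet.isSelfAdjoint_compDiff_iff hol hΦ,
    HardyDirichlet.compDiff_eq_toPMap hΦ hT, HardyDirichlet.isSelfAdjoint_toPMap_top_iff]
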